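/- An election consists of a set $C$ of $m$ candidates and a profile $(v_1,\dots,v_n)$ of total orders (votes) on $C$. For candidates $c\neq d$ let $\mathcal M_E(c,d)$ be the number of voters preferring $c$ to $d$; let $\mathcal P_E(c)\in\mathbb N^m$ be the vector whose $i$-th entry is the number of voters ranking $c$ on position $i$; let $\mathcal B_E(c)=\sum_{i}(m-\mathrm{pos}_{v_i}(c))$ be the Borda score, $\mathcal B_E$ the vector of Borda scores. For vectors put $\ell_1(x,y)=\sum_i|x_i-y_i|$ and $\mathrm{emd}(x,y)=\ell_1(\hat x,\hat y)$, where $\hat x_i=x_1+\dots+x_i$. For elections $E=(C,(v_i))$ and $E'=(C',(v'_i))$ with the same $m$ and $n$ let, with $\sigma$ ranging over the bijections $C\to C'$ and $\rho$ over the permutations of $\{1,\dots,n\}$, \[ d(E,E')=\min_{\sigma}\min_{\rho}\sum_{i=1}^n d(\sigma(v_i),v'_{\rho(i)})\quad\text{for } d\in\{d_{\mathrm{disc}},d_{\mathrm{swap}}\}, \] where on votes $d_{\mathrm{disc}}$ is $0$ if they are equal and $1$ otherwise, and $d_{\mathrm{swap}}$ is the number of pairs of candidates ranked in opposite order; and \[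 d_{\mathrm{pos}}^{\mathrm{emd}}(E,E')=\min_\sigma\sum_{c\in C}\mathrm{emd}(\mathcal P_E(c),\mathcal P_{E'}(\sigma(c))),\qquad d_{\mathrm{pos}}^{\ell_1}(E,E')=\min_\sigma\sum_{c\in C}\ell_1(\mathcal P_E(c),\mathcal P_{E'}(\sigma(c))), \] \[ d_{\mathrm{pair}}(E,E')=\min_\sigma\sum_{a\ne b}|\mathcal M_E(a,b)-\mathcal M_{E'}(\sigma(a),\sigma(b))|,\qquad d_{\mathrm{Borda}}(E,E')=\mathrm{emd}(\mathrm{sort}(\mathcal B_E),\mathrm{sort}(\mathcal B_{E'})), \] where $\mathrm{sort}$ sorts in nonincreasing order and the sum for $d_{\mathrm{pair}}$ is over ordered pairs. Let $m$ be even and $n=t\cdot m!$ with $t\ge 1$ an integer. The compass elections with $m$ candidates and $n$ voters are: $\mathrm{ID}$, where all votes are equal; $\mathrm{AN}$, where half of the votes equal some order and the other half equal its reverse; $\mathrm{UN}$, where each of the $m!$ votes appears the same number of times; $\mathrm{ST}$, where the candidates are partitioned into two equal-sized sets $A$ and $B$, the votes all rank every member of $A$ ahead of every member of $B$, and each such order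 appears the same number of times. **Proposition.** There are absolute constants $c,K>0$ such that, for all even $m\ge 4$, all $t\ge 1$, $n=t\cdot m!$, and all compass elections $X$ and $Y$ of two different kinds among $\mathrm{ID},\mathrm{AN},\mathrm{UN},\mathrm{ST}$ with $m$ candidates and $n$ voters, \[ c\,nm^2\le d_{\mathrm{swap}}(X,Y),\ d_{\mathrm{pos}}^{\mathrm{emd}}(X,Y)\le K\,nm^2,\quad c\,nm\le d_{\mathrm{pos}}^{\ell_1}(X,Y)\le K\,nm,\quad c\,n\le d_{\mathrm{disc}}(X,Y)\le K\,n, \] and, unless the two kinds are $\mathrm{AN}$ and $\mathrm{UN}$, \[ c\,nm^3\le d_{\mathrm{Borda}}(X,Y)\le K\,nm^3,\qquad c\,nm^2\le d_{\mathrm{pair}}(X,Y)\le K\,nm^2. \] For all even $m\ge 2$ and all $t\ge1$, the pairwise and the Bordawise distances between $\mathrm{AN}$ and $\mathrm{UN}$, in either order, are $0$. -/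

import Mathlib

open scoped Nat

universe u v

noncomputable section

namespace Election

/-- A total order on a set of `m` candidates, given by the position of each candidate: position
`0` is the top one (so the position counted from `1` is `(v c : ℕ) + 1`), and `c` is preferred to
`d` iff `v c < v d`. -/
abbrev Vote (C : Type*) (m : ℕ) := C ≃ Fin m

/-- A preference profile of `n` votes over the candidate set `C`, where `|C| = m`. -/
abbrev Profile (C : Type*) (m n : ℕ) := Fin n → Vote C m

section Representations

variable {C : Type*} {m n : ℕ}

/-- The number of voters that prefer `c` to `d`. -/
def majority (E : Profile C m n) (c d : C) : ℕ :=
  (Finset.univ.filter fun i => E i c < E i d).card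

/-- The number of voters that rank `c` on position `j`; `position E c` is the position vector
of `c`. -/
def position (E : Profile C m n) (c : C) (j : Fin m) : ℕ :=
  (Finset.univ.filter fun i => E i c = j).card

/-- The Borda score of `c`: the sum over all votes of `m` minus the position of `c`, with
positions counted from `1`; the subtraction never truncates. -/
def borda (E : Profile C m n) (c : C) : ℕ :=
  ∑ i, (m - ((E i c : ℕ) + 1))

end Representations

/-- The `ℓ₁` distance of two vectors. -/
def l1 {m : ℕ} (x y : Fin m → ℝ) : ℝ := ∑ i, |x i - y i|

/-- The vector of prefix sums. -/
def prefixSum {m : ℕ} (x : Fin m → ℝ) : Fin m → ℝ := fun i => ∑ j ∈ Finset.Iic i, x j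

/-- The earth mover's distance (of nonnegative vectors with equal sums). -/
def emd {m : ℕ} (x y : Fin m → ℝ) : ℝ := l1 (prefixSum x) (prefixSum y)

/-- The entries of a vector `x` indexed by an `m`-element set `C`, in nonincreasing order. -/
def sortDesc {C : Type*} [Fintype C] (m : ℕ) (x : C → ℕ) : Fin m → ℝ :=
  fun i => (((Finset.univ.val.map x).sort (· ≥ ·)).getD i 0 : ℕ)

section Distances

variable {C : Type*} {D : Type*} [Fintype C] [Fintype D] [DecidableEq C] [DecidableEq D] {m n : ℕ}

/-- The vote obtained from `v` by replacing each candidate `c` with `σ c`. -/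
def rename (σ : C ≃ D) (v : Vote C m) : Vote D m := σ.symm.trans v

/-- The discrete distance of two votes. -/
def discVote (u v : Vote D m) : ℝ := if u = v then 0 else 1

/-- The swap distance of two votes: the number of pairs of candidates that `u` and `v` rank in
opposite order; each such pair is counted once, in the order of `u`. -/
def swapVote (u v : Vote D m) : ℝ :=
  ((Finset.univ : Finset (D × D)).filter fun p => u p.1 < u p.2 ∧ v p.2 < v p.1).card

/-- The isomorphic extension of a distance `d` of votes to profiles. -/
def isoDist (d : Vote D m → Vote D m → ℝ) (E : Profile C m n) (E' : Profile D m n) : ℝ :=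
  ⨅ σ : C ≃ D, ⨅ ρ : Equiv.Perm (Fin n), ∑ i, d (rename σ (E i)) (E' (ρ i))

/-- The discrete isomorphic distance. -/
def dDisc (E : Profile C m n) (E' : Profile D m n) : ℝ := isoDist discVote E E'

/-- The swap isomorphic distance. -/
def dSwap (E : Profile C m n) (E' : Profile D m n) : ℝ := isoDist swapVote E E'

/-- The EMD-positionwise distance. -/
def dPosEmd (E : Profile C m n) (E' : Profile D m n) : ℝ :=
  ⨅ σ : C ≃ D, ∑ c, emd (fun j => (position E c j : ℝ)) (fun j => (position E' (σ c) j : ℝ))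

/-- The `ℓ₁`-positionwise distance. -/
def dPosL1 (E : Profile C m n) (E' : Profile D m n) : ℝ :=
  ⨅ σ : C ≃ D, ∑ c, l1 (fun j => (position E c j : ℝ)) (fun j => (position E' (σ c) j : ℝ))

/-- The pairwise distance; the sum is over ordered pairs of distinct candidates. -/
def dPair (E : Profile C m n) (E' : Profile D m n) : ℝ :=
  ⨅ σ : C ≃ D, ∑ p ∈ (Finset.univ : Finset C).offDiag,
    |(majority E p.1 p.2 : ℝ) - (majority E' (σ p.1) (σ p.2) : ℝ)|

/-- The Bordawise distance. -/
def dBorda (E : Profile C m n) (E' : Profile D m n) : ℝ :=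
  emd (sortDesc m (borda E)) (sortDesc m (borda E'))

end Distances

section CompassElections

variable {C : Type*} [Fintype C] [DecidableEq C] {m n : ℕ}

/-- How many times the vote `v` appears in `E`. -/
def count (E : Profile C m n) (v : Vote C m) : ℕ := (Finset.univ.filter fun i => E i = v).card

/-- The opposite preference order. -/
def reverse (v : Vote C m) : Vote C m := v.trans Fin.revPerm

/-- All voters have the same preference order. -/
def IsID (E : Profile C m n) : Prop := ∃ v, ∀ i, E i = v

/-- Half of the voters have the preference order `v`, the other half the opposite one. -/
def IsAN (E : Profile C m n) : Prop :=
  ∃ v, ∃ S : Finset (Fin n), 2 * S.card = n ∧ (∀ i ∈ S, E i = v) ∧ ∀ i ∉ S, E i = reverse v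

/-- Each possible vote appears the same number of times. -/
def IsUN (E : Profile C m n) : Prop := ∀ u v : Vote C m, count E u = count E v

/-- All members of `A` are ranked ahead of all the other candidates. -/
def Ahead (A : Finset C) (v : Vote C m) : Prop := ∀ a ∈ A, ∀ b ∉ A, v a < v b

/-- The candidates are partitioned into equal-sized sets `A` and `Aᶜ`; exactly the votes that
rank `A` ahead of `Aᶜ` are possible, and each of them appears the same number of times. -/
def IsST (E : Profile C m n) : Prop :=
  ∃ A : Finset C, A.card = Aᶜ.card ∧ (∀ i, Ahead A (E i)) ∧
    ∀ u v : Vote C m, Ahead A u → Ahead A v → count E u = count E v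

/-- The four kinds of compass elections: identity, antagonism, uniformity, stratification. -/
inductive Compass where
  | ID
  | AN
  | UN
  | ST

/-- `E` is a compass election of the given kind. -/
def IsCompass : Compass → Profile C m n → Prop
  | .ID, E => IsID E
  | .AN, E => IsAN E
  | .UN, E => IsUN E
  | .ST, E => IsST E

end CompassElections

end Election

end

set_option linter.unusedSectionVars false

namespace Election

open Finset

/-! ### Sums over centred positions -/

/-! Write `m = 2 * h`. The upper bounds are crude counts. All lower bounds come from one kind of
test: choose a function `f` of the position with steps of size at most 2, and let `score f E c` be
the sum of `f` over the positions of `c`. Moving candidates changes the scores slowly, so for every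
matching `σ` the total score difference is at most a constant times the EMD cost
(`abs_score_sub_le_emd`) or the swap cost (`score_sub_le_swap`). For `f = centered m`, an affine
image of the Borda score, it is also bounded by the pairwise cost (`score_sub_le_pair`).

It remains to separate the kinds by order `n * h ^ 2`. With `centered`, the scores of ID spread
linearly over the candidates, those of AN and UN vanish, and those of ST are `-n * h` on one half
and `n * h` on the other. Only AN and UN coincide. They are separated by `|centered|`: in AN each
candidate keeps its distance from the middle, in UN all candidates have the same average distance
(`exists_separating_score`). The ℓ₁ and discrete bounds follow from EMD and swap, since `emd ≤ m *
l1` and `swapVote ≤ m ^ 2 * discVote`.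

For Borda, the sorted vector can be written explicitly because `drift` is monotone, and its prefix
sums differ by order `n * k * (h - k)`, which adds up to order `n * h ^ 3`. -/

/-- Twice the signed distance of position `k` from the middle position `(m - 1) / 2`. -/
noncomputable def centered (m k : ℕ) : ℝ := 2 * k + 1 - m

lemma sum_range_odd (h : ℕ) : ∑ j ∈ range h, (2 * (j : ℝ) + 1) = (h : ℝ) ^ 2 := by
  induction h with
  | zero => simp
  | succ k ih => rw [sum_range_succ, ih]; push_cast; ring

lemma sum_centered_half (h : ℕ) : ∑ j ∈ range h, centered (2 * h) j = -(h : ℝ) ^ 2 := by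
  simp only [centered, sum_sub_distrib, sum_range_odd, sum_const, card_range, nsmul_eq_mul]
  push_cast; ring

lemma sum_abs_centered (h : ℕ) : ∑ j ∈ range (2 * h), |centered (2 * h) j| = 2 * (h : ℝ) ^ 2 := by
  rw [two_mul h, sum_range_add, ← two_mul h]
  have h1 : ∀ j ∈ range h, |centered (2 * h) j| = 2 * h - (2 * (j : ℝ) + 1) := by
    intro j hj
    have : (j : ℝ) + 1 ≤ h := by exact_mod_cast mem_range.1 hj
    rw [centered, abs_of_nonpos (by push_cast; linarith)]
    push_cast; ring
  have h2 : ∀ j ∈ range h, |centered (2 * h) (h + j)| = 2 * (j : ℝ) + 1 := by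
    intro j _
    rw [centered]
    have : (2 * ((h + j : ℕ) : ℝ) + 1 - ((2 * h : ℕ) : ℝ)) = 2 * (j : ℝ) + 1 := by
      push_cast; ring
    rw [this, abs_of_nonneg (by positivity)]
  rw [sum_congr rfl h1, sum_congr rfl h2, sum_sub_distrib, sum_range_odd]
  simp; ring

lemma sum_sq_sub (M : ℝ) (N : ℕ) :
    ∑ j ∈ range N, (2 * (j : ℝ) + 1 - M) ^ 2 =
      N * (4 * (N : ℝ) ^ 2 - 1) / 3 - 2 * M * (N : ℝ) ^ 2 + M ^ 2 * N := by
  induction N with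
  | zero => simp
  | succ k ih => rw [sum_range_succ, ih]; push_cast; ring

lemma abs_centered_le {h j : ℕ} (hj : j < 2 * h) : |centered (2 * h) j| ≤ 2 * h := by
  have : (j : ℝ) + 1 ≤ 2 * h := by exact_mod_cast hj
  have h0 : (0 : ℝ) ≤ j := by positivity
  rw [centered, abs_le]; push_cast; constructor <;> linarith

/-- Each deviation is at most `h`, so its square is at most `h` times its absolute value; the second
moment is computable exactly and gives `2 * (h ^ 2 - 1) / 3`. This reaches `h ^ 2 / 2` precisely
when `h ≥ 2`; for `h = 1` every deviation is zero. -/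
lemma le_sum_abs_centered_sub {h : ℕ} (hh : 2 ≤ h) :
    (h : ℝ) ^ 2 / 2 ≤ ∑ j ∈ range (2 * h), |(|centered (2 * h) j| - h)| := by
  have hh' : (2 : ℝ) ≤ h := by exact_mod_cast hh
  have key : ∑ j ∈ range (2 * h), (|centered (2 * h) j| - h) ^ 2
      ≤ h * ∑ j ∈ range (2 * h), |(|centered (2 * h) j| - h)| := by
    rw [mul_sum]
    refine sum_le_sum fun j hj => ?_
    rw [← sq_abs, sq]
    refine mul_le_mul_of_nonneg_right ?_ (abs_nonneg _)
    have := abs_centered_le (mem_range.1 hj)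
    have := abs_nonneg (centered (2 * h) j)
    rw [abs_le]; constructor <;> linarith
  have e : ∑ j ∈ range (2 * h), (|centered (2 * h) j| - h) ^ 2
      = 2 * h * ((h : ℝ) ^ 2 - 1) / 3 := by
    have : ∀ j ∈ range (2 * h), (|centered (2 * h) j| - h) ^ 2 =
        (2 * (j : ℝ) + 1 - (2 * h : ℕ)) ^ 2 - 2 * h * |centered (2 * h) j| + (h : ℝ) ^ 2 := by
      intro j _
      rw [sub_sq, sq_abs]; simp only [centered]; ring
    rw [sum_congr rfl this, sum_add_distrib, sum_sub_distrib, ← mul_sum, sum_abs_centered,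
      sum_sq_sub]
    simp; ring
  rw [e] at key
  have : 2 * ((h : ℝ) ^ 2 - 1) / 3 ≤ ∑ j ∈ range (2 * h), |(|centered (2 * h) j| - h)| := by
    refine le_of_mul_le_mul_left ?_ (show (0 : ℝ) < h by linarith)
    linarith
  nlinarith

lemma sum_vote {C : Type*} [Fintype C] {m : ℕ} (v : Vote C m) (f : ℕ → ℝ) :
    ∑ c, f (v c) = ∑ j ∈ range m, f j := by
  rw [Equiv.sum_comp v (fun j : Fin m => f j), Fin.sum_univ_eq_sum_range]

/-! ### Scores -/

section Score

variable {C : Type*} {D : Type*} {m n : ℕ}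

/-- The total over all votes of `f` evaluated at the position of `c`. -/
noncomputable def score (f : ℕ → ℝ) (E : Profile C m n) (c : C) : ℝ := ∑ i, f (E i c)

lemma two_mul_borda (E : Profile C m n) (c : C) :
    2 * (borda E c : ℝ) = n * (m - 1) - score (centered m) E c := by
  have : ∀ i, ((m - ((E i c : ℕ) + 1) : ℕ) : ℝ) = m - (E i c + 1) := by
    intro i
    rw [Nat.cast_sub (E i c).2]; push_cast; ring
  simp only [borda, score, centered, Nat.cast_sum, this, mul_sum]
  have h2 : (n : ℝ) * (m - 1) = ∑ _i : Fin n, ((m : ℝ) - 1) := by simp [mul_sub]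
  rw [h2, ← sum_sub_distrib]
  exact sum_congr rfl fun i _ => by ring

lemma majority_eq_sum (E : Profile C m n) (c d : C) :
    (majority E c d : ℝ) = ∑ i, if E i c < E i d then 1 else 0 := by
  simp [majority]

lemma borda_eq_sum_majority [Fintype C] (E : Profile C m n) (c : C) :
    (borda E c : ℝ) = ∑ d, (majority E c d : ℝ) := by
  simp only [majority_eq_sum, borda, Nat.cast_sum]
  rw [sum_comm]
  refine sum_congr rfl fun i _ => ?_
  rw [Equiv.sum_comp (E i) (fun j => if E i c < j then (1 : ℝ) else 0)]
  rw [sum_boole]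
  congr 1
  rw [show ({j | E i c < j} : Finset (Fin m)) = Ioi (E i c) by ext; simp, Fin.card_Ioi]
  omega

lemma prefixSum_position (E : Profile C m n) (c : C) (k : Fin m) :
    prefixSum (fun j => (position E c j : ℝ)) k = ∑ i, if E i c ≤ k then 1 else 0 := by
  simp only [prefixSum, position]
  have : ∀ j, (((univ.filter fun i => E i c = j).card : ℕ) : ℝ)
      = ∑ i, if E i c = j then 1 else 0 := by intro j; simp
  simp only [this]
  rw [sum_comm]
  refine sum_congr rfl fun i _ => ?_
  rw [sum_ite_eq]
  simp only [mem_Iic]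

/-- Telescoping from `p` up to `m`. Written with indicators of `p ≤ k`, it becomes, after summing
over voters, a linear expression in the prefix sums of the position vector, which are what `emd`
compares. -/
lemma apply_eq_sub_sum (f : ℕ → ℝ) (p : Fin m) :
    f p = f m - ∑ k : Fin m, (f (k + 1) - f k) * if p ≤ k then 1 else 0 := by
  have h1 : ∑ k : Fin m, (f (k + 1) - f k) * (if p ≤ k then 1 else 0)
      = ∑ k ∈ range m, if (p : ℕ) ≤ k then f (k + 1) - f k else 0 := by
    rw [← Fin.sum_univ_eq_sum_range (fun k => if (p : ℕ) ≤ k then f (k + 1) - f k else 0)]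
    refine sum_congr rfl fun k _ => ?_
    simp only [mul_ite, mul_one, mul_zero, Fin.le_iff_val_le_val]
  rw [h1, ← sum_filter]
  have h2 : (range m).filter (fun k => (p : ℕ) ≤ k) = Ico (p : ℕ) m := by
    ext; simp; omega
  rw [h2, sum_Ico_eq_sub _ p.2.le, sum_range_sub, sum_range_sub]
  ring

lemma score_eq (f : ℕ → ℝ) (E : Profile C m n) (c : C) :
    score f E c = n * f m -
      ∑ k : Fin m, (f (k + 1) - f k) * prefixSum (fun j => (position E c j : ℝ)) k := by
  simp only [prefixSum_position, mul_sum]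
  rw [sum_comm, show (n : ℝ) * f m = ∑ _i : Fin n, f m by simp, ← sum_sub_distrib]
  exact sum_congr rfl fun i _ => apply_eq_sub_sum f _

lemma abs_score_sub_le_emd {L : ℝ} {f : ℕ → ℝ} (hf : ∀ k, |f (k + 1) - f k| ≤ L)
    (E : Profile C m n) (E' : Profile D m n) (c : C) (d : D) :
    |score f E c - score f E' d| ≤
      L * emd (fun j => (position E c j : ℝ)) (fun j => (position E' d j : ℝ)) := by
  rw [score_eq, score_eq, sub_sub_sub_cancel_left, ← sum_sub_distrib, emd, l1, mul_sum]
  refine (abs_sum_le_sum_abs _ _).trans (sum_le_sum fun k _ => ?_)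
  rw [← mul_sub, abs_mul, abs_sub_comm (prefixSum _ _)]
  exact mul_le_mul_of_nonneg_right (hf k) (abs_nonneg _)

lemma abs_sub_le_of_step {L : ℝ} {f : ℕ → ℝ} (hf : ∀ k, |f (k + 1) - f k| ≤ L) (a b : ℕ) :
    |f a - f b| ≤ L * |(a : ℝ) - b| := by
  wlog hab : b ≤ a generalizing a b
  · rw [abs_sub_comm, abs_sub_comm (a : ℝ)]; exact this b a (by omega)
  rw [abs_of_nonneg (sub_nonneg.2 (by exact_mod_cast hab : (b : ℝ) ≤ a))]
  induction a, hab using Nat.le_induction with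
  | base => simp
  | succ k _ ih =>
    have := abs_sub_le (f (k + 1)) (f k) (f b)
    have := hf k
    push_cast; linarith

lemma emd_le_mul_l1 (x y : Fin m → ℝ) : emd x y ≤ m * l1 x y := by
  have : ∀ k : Fin m, |prefixSum x k - prefixSum y k| ≤ l1 x y := by
    intro k
    simp only [prefixSum, l1]
    rw [← sum_sub_distrib]
    exact (abs_sum_le_sum_abs _ _).trans
      (sum_le_sum_of_subset_of_nonneg (subset_univ _) fun _ _ _ => abs_nonneg _)
  rw [emd, l1]
  exact (sum_le_sum fun k _ => this k).trans (by simp)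

end Score

/-! ### Comparison of distances of votes -/

section Votes

variable {D : Type*} [Fintype D] {m : ℕ}

lemma val_eq_card (u : Vote D m) (c : D) :
    (u c : ℕ) = (univ.filter fun d => u d < u c).card := by
  rw [← card_map u.toEmbedding]
  have : (univ.filter fun d => u d < u c).map u.toEmbedding = Iio (u c) := by
    ext j
    simp only [mem_map_equiv, mem_filter, mem_univ, true_and, Equiv.apply_symm_apply, mem_Iio]
  rw [this, Fin.card_Iio]

/-- The position of `c` counts the candidates ranked above it; those above `c` in `u` are either
above it in `v` too or form an inverted pair with it. -/
lemma val_sub_le [DecidableEq D] (u v : Vote D m) (c : D) :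
    (u c : ℝ) - v c ≤ (univ.filter fun d => u d < u c ∧ v c < v d).card := by
  have : (u c : ℕ) ≤ v c + (univ.filter fun d => u d < u c ∧ v c < v d).card := by
    rw [val_eq_card u, val_eq_card v]
    refine (card_le_card ?_).trans (card_union_le _ _)
    intro d hd
    simp only [mem_filter, mem_univ, true_and, mem_union] at hd ⊢
    rcases lt_trichotomy (v d) (v c) with h | h | h
    · exact Or.inl h
    · rw [v.injective h] at hd; exact absurd hd (lt_irrefl _)
    · exact Or.inr ⟨hd, h⟩
  rw [sub_le_iff_le_add']; exact_mod_cast this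

lemma swapVote_eq_sum (u v : Vote D m) :
    swapVote u v = ∑ c, ((univ.filter fun d => u d < u c ∧ v c < v d).card : ℝ) := by
  simp only [swapVote, card_filter, Nat.cast_sum]
  rw [← univ_product_univ, sum_product_right]

lemma swapVote_comm (u v : Vote D m) : swapVote u v = swapVote v u := by
  rw [swapVote, swapVote, ← card_map (Equiv.prodComm D D).toEmbedding]
  congr 2
  ext p
  simp [and_comm]

/-- The Diaconis–Graham inequality: Spearman's footrule is at most twice the Kendall distance,
because each inverted pair is charged to both of its members. -/
lemma sum_abs_sub_le_swapVote [DecidableEq D] (u v : Vote D m) :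
    ∑ c, |(u c : ℝ) - v c| ≤ 2 * swapVote u v := by
  have h1 : 2 * swapVote u v = swapVote u v + swapVote v u := by rw [swapVote_comm v u]; ring
  rw [h1, swapVote_eq_sum, swapVote_eq_sum, ← sum_add_distrib]
  refine sum_le_sum fun c _ => ?_
  have h1 := val_sub_le u v c
  have h2 := val_sub_le v u c
  rw [abs_le]
  constructor
  · have : (0 : ℝ) ≤ ((univ.filter fun d => u d < u c ∧ v c < v d).card : ℝ) := by positivity
    linarith
  · have : (0 : ℝ) ≤ ((univ.filter fun d => v d < v c ∧ u c < u d).card : ℝ) := by positivity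
    linarith

lemma card_of_vote (u : Vote D m) : Fintype.card D = m := by
  simpa using Fintype.card_congr u

lemma swapVote_le [DecidableEq D] (u v : Vote D m) : swapVote u v ≤ (m : ℝ) ^ 2 * discVote u v := by
  rw [discVote]
  split_ifs with h
  · subst h
    rw [swapVote, mul_zero, filter_eq_empty_iff.2]
    · simp
    · rintro p - ⟨h1, h2⟩; exact lt_asymm h1 h2
  · rw [swapVote, mul_one]
    have := card_le_univ ((univ : Finset (D × D)).filter fun p => u p.1 < u p.2 ∧ v p.2 < v p.1)
    rw [Fintype.card_prod, card_of_vote u, ← sq] at this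
    exact_mod_cast this

end Votes

/-! ### Structure of the compass elections -/

section Kinds

variable {C : Type*} [Fintype C] [DecidableEq C] {m n : ℕ}

lemma centered_rev {m : ℕ} (j : Fin m) : centered m (Fin.rev j) = -centered m j := by
  have : ((Fin.rev j : Fin m) : ℝ) = m - (j + 1) := by
    rw [Fin.val_rev, Nat.cast_sub j.2]; push_cast; ring
  simp only [centered, this]; ring

lemma sum_count_mul (E : Profile C m n) (F : Vote C m → ℝ) :
    ∑ i, F (E i) = ∑ v, (count E v : ℝ) * F v := by
  rw [← sum_fiberwise_of_maps_to (g := E) (t := univ) (by simp)]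
  refine sum_congr rfl fun v _ => ?_
  rw [count, ← nsmul_eq_mul, ← sum_const]
  exact sum_congr rfl fun i hi => by rw [(mem_filter.1 hi).2]

/-- A relabelling that preserves multiplicities permutes the multiset of votes. This is how the
symmetry of UN and ST is used. -/
lemma sum_comp_of_count_eq {E : Profile C m n} {T : Vote C m ≃ Vote C m}
    (hT : ∀ v, count E (T v) = count E v) (F : Vote C m → ℝ) :
    ∑ i, F (T (E i)) = ∑ i, F (E i) := by
  rw [sum_count_mul E F, sum_count_mul E fun v => F (T v),
    ← Equiv.sum_comp T fun v => (count E v : ℝ) * F v]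
  exact sum_congr rfl fun v _ => by rw [hT]

/-- Relabelling the candidates of a vote by a transposition. -/
def relabel (m : ℕ) (a b : C) : Vote C m ≃ Vote C m where
  toFun v := (Equiv.swap a b).trans v
  invFun v := (Equiv.swap a b).trans v
  left_inv v := by ext; simp
  right_inv v := by ext; simp

lemma relabel_left (a b : C) (v : Vote C m) : relabel m a b v a = v b := by simp [relabel]

lemma relabel_right (a b : C) (v : Vote C m) : relabel m a b v b = v a := by simp [relabel]

lemma score_eq_of_relabel {E : Profile C m n} {a b : C}
    (h : ∀ v, count E (relabel m a b v) = count E v) (f : ℕ → ℝ) :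
    score f E a = score f E b := by
  have := sum_comp_of_count_eq h fun v => f (v a)
  simp only [relabel_left] at this
  exact this.symm

lemma sum_score (E : Profile C m n) (f : ℕ → ℝ) :
    ∑ c, score f E c = n * ∑ j ∈ range m, f j := by
  simp only [score]
  rw [sum_comm]
  simp [sum_vote]

lemma IsID.score {E : Profile C m n} (hE : IsID E) :
    ∃ v : Vote C m, ∀ f c, score f E c = n * f (v c) := by
  obtain ⟨v, hv⟩ := hE
  exact ⟨v, fun f c => by simp [Election.score, hv]⟩

lemma IsAN.sum {E : Profile C m n} (hE : IsAN E) :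
    ∃ v : Vote C m, ∀ F : Vote C m → ℝ, ∑ i, F (E i) = n / 2 * (F v + F (reverse v)) := by
  obtain ⟨v, S, hS, h1, h2⟩ := hE
  refine ⟨v, fun F => ?_⟩
  have hS' : (2 : ℝ) * S.card = n := by exact_mod_cast hS
  have hc : (S.card : ℝ) + Sᶜ.card = n := by
    have := card_add_card_compl S
    rw [Fintype.card_fin] at this
    exact_mod_cast this
  have e1 : ∑ i ∈ S, F (E i) = ∑ _i ∈ S, F v := sum_congr rfl fun i hi => by rw [h1 i hi]
  have e2 : ∑ i ∈ Sᶜ, F (E i) = ∑ _i ∈ Sᶜ, F (reverse v) :=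
    sum_congr rfl fun i hi => by rw [h2 i (mem_compl.1 hi)]
  rw [← sum_add_sum_compl S, e1, e2, sum_const, sum_const, nsmul_eq_mul, nsmul_eq_mul, show (S.card : ℝ) = n / 2 by linarith,
    show (Sᶜ.card : ℝ) = n / 2 by linarith]
  ring

lemma IsAN.score_centered {E : Profile C m n} (hE : IsAN E) (c : C) :
    score (centered m) E c = 0 := by
  obtain ⟨v, hv⟩ := hE.sum
  rw [score, hv fun u => centered m (u c)]
  have : reverse v c = Fin.rev (v c) := rfl
  rw [this, centered_rev]; ring

lemma IsAN.score_abs_centered {E : Profile C m n} (hE : IsAN E) :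
    ∃ v : Vote C m, ∀ c, score (fun k => |centered m k|) E c = n * |centered m (v c)| := by
  obtain ⟨v, hv⟩ := hE.sum
  refine ⟨v, fun c => ?_⟩
  rw [score, hv fun u => |centered m (u c)|]
  have : reverse v c = Fin.rev (v c) := rfl
  rw [this, centered_rev, abs_neg]; ring

lemma IsAN.majority {E : Profile C m n} (hE : IsAN E) {a b : C} (hab : a ≠ b) :
    (majority E a b : ℝ) = n / 2 := by
  obtain ⟨v, hv⟩ := hE.sum
  rw [majority_eq_sum, hv fun u => if u a < u b then 1 else 0]
  have hr : (reverse v a < reverse v b) ↔ v b < v a := by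
    change Fin.rev (v a) < Fin.rev (v b) ↔ _
    exact Fin.rev_lt_rev
  rcases lt_or_gt_of_ne (v.injective.ne hab) with h | h
  · rw [if_pos h, if_neg (by rw [hr]; exact h.not_gt)]; ring
  · rw [if_neg h.not_gt, if_pos (by rw [hr]; exact h)]; ring

lemma IsUN.mul_score {E : Profile C m n} (hE : IsUN E) (f : ℕ → ℝ) (c : C) :
    m * score f E c = n * ∑ j ∈ range m, f j := by
  -- A vote is needed to know that there are `m` candidates, so the empty profile is treated apart.
  rcases Nat.eq_zero_or_pos n with rfl | hn
  · simp [score]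
  rw [← sum_score E f, sum_congr rfl fun d _ =>
    score_eq_of_relabel (a := d) (b := c) (fun v => hE _ _) f]
  simp [card_of_vote (E ⟨0, hn⟩)]

lemma IsUN.majority {E : Profile C m n} (hE : IsUN E) {a b : C} (hab : a ≠ b) :
    (majority E a b : ℝ) = n / 2 := by
  have h1 := sum_comp_of_count_eq (T := relabel m a b) (fun v => hE _ v)
    fun v => if v a < v b then 1 else 0
  simp only [relabel_left, relabel_right] at h1
  have h2 : (∑ i, if E i b < E i a then (1 : ℝ) else 0) + ∑ i, (if E i a < E i b then 1 else 0)
      = n := by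
    rw [← sum_add_distrib]
    have : ∀ i, ((if E i b < E i a then (1 : ℝ) else 0) + if E i a < E i b then 1 else 0) = 1 := by
      intro i
      rcases lt_or_gt_of_ne ((E i).injective.ne hab) with h | h
      · simp [h, h.not_gt]
      · simp [h, h.not_gt]
    simp [this]
  rw [majority_eq_sum]; linarith

lemma IsUN.score_centered {h : ℕ} {E : Profile C (2 * h) n} (hE : IsUN E) (hh : 0 < h) (c : C) :
    score (centered (2 * h)) E c = 0 := by
  have h1 := hE.mul_score (centered (2 * h)) c
  have h2 : ∑ j ∈ range (2 * h), centered (2 * h) j = 0 := by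
    simp only [centered, sum_sub_distrib, sum_range_odd]
    simp; ring
  rw [h2, mul_zero] at h1
  exact (mul_eq_zero.1 h1).resolve_left (by positivity)

lemma IsUN.score_abs_centered {h : ℕ} {E : Profile C (2 * h) n} (hE : IsUN E) (hh : 0 < h)
    (c : C) : score (fun k => |centered (2 * h) k|) E c = n * h := by
  have h1 := hE.mul_score (fun k => |centered (2 * h) k|) c
  rw [sum_abs_centered] at h1
  have : (h : ℝ) ≠ 0 := by positivity
  push_cast at h1
  refine mul_left_cancel₀ (mul_ne_zero two_ne_zero this) ?_
  linarith

/-- If `c ∈ A`, everything ranked at or above `c` lies in `A`; otherwise all of `A` is strictly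
above `c`. Counting positions gives both directions. -/
lemma mem_iff_lt_of_ahead {A : Finset C} {v : Vote C m} (hv : Ahead A v) (c : C) :
    c ∈ A ↔ (v c : ℕ) < A.card := by
  constructor
  · intro hc
    have : A.card ≥ (Iic (v c)).card := by
      rw [← card_map v.symm.toEmbedding]
      refine card_le_card fun d hd => ?_
      simp only [mem_map_equiv, Equiv.symm_symm, mem_Iic] at hd
      by_contra hdA
      exact (hv c hc d hdA).not_ge hd
    rw [Fin.card_Iic] at this
    omega
  · intro hlt
    by_contra hc
    have : A.card ≤ (Iio (v c)).card := by
      rw [← card_map v.toEmbedding]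
      refine card_le_card fun j hj => ?_
      simp only [mem_map_equiv, mem_Iio] at hj ⊢
      simpa using hv _ hj c hc
    rw [Fin.card_Iio] at this
    omega

lemma ahead_relabel {A : Finset C} {a b : C} (hab : a ∈ A ↔ b ∈ A) (v : Vote C m) :
    Ahead A (relabel m a b v) ↔ Ahead A v := by
  have hs : ∀ c, Equiv.swap a b c ∈ A ↔ c ∈ A := by
    intro c
    rcases eq_or_ne c a with rfl | hca
    · simp [hab]
    rcases eq_or_ne c b with rfl | hcb
    · simp [hab]
    rw [Equiv.swap_apply_of_ne_of_ne hca hcb]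
  constructor
  · intro h x hx y hy
    have := h (Equiv.swap a b x) ((hs x).2 hx) (Equiv.swap a b y) (fun h => hy ((hs y).1 h))
    simpa [relabel] using this
  · intro h x hx y hy
    exact h (Equiv.swap a b x) ((hs x).2 hx) (Equiv.swap a b y) (fun h => hy ((hs y).1 h))

lemma count_eq_zero {E : Profile C m n} {P : Vote C m → Prop} (hP : ∀ i, P (E i)) {v : Vote C m}
    (hv : ¬ P v) : count E v = 0 := by
  rw [count, card_eq_zero, filter_eq_empty_iff]
  rintro i - rfl
  exact hv (hP i)

lemma sum_centered_of_ahead {h : ℕ} {A : Finset C} (hA : A.card = h) {v : Vote C (2 * h)}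
    (hv : Ahead A v) : ∑ c ∈ A, centered (2 * h) (v c) = -(h : ℝ) ^ 2 := by
  rw [← sum_centered_half]
  refine sum_bij (fun c _ => (v c : ℕ)) ?_ ?_ ?_ ?_
  · intro c hc
    exact mem_range.2 (((mem_iff_lt_of_ahead hv c).1 hc).trans_eq hA)
  · intro c _ d _ hcd
    exact v.injective (Fin.ext hcd)
  · intro j hj
    rw [mem_range] at hj
    refine ⟨v.symm ⟨j, by omega⟩, ?_, by simp⟩
    rw [mem_iff_lt_of_ahead hv, hA]; simpa using hj
  · intro c _; rfl

/-- Transpositions inside a block preserve the profile, so the score is constant on `A` and on `Aᶜ`.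
The scores on `A` add up to `-n * h ^ 2`, and all scores together to `0`, which determines both
constants. -/
lemma IsST.score_centered {h : ℕ} {E : Profile C (2 * h) n} (hE : IsST E) (hh : 0 < h)
    (hn : 0 < n) : ∃ v : Vote C (2 * h), ∀ c, score (centered (2 * h)) E c =
      if (v c : ℕ) < h then -(n * h : ℝ) else n * h := by
  obtain ⟨A, hA, h1, h2⟩ := hE
  have hm := card_of_vote (E ⟨0, hn⟩)
  have hc := card_add_card_compl A
  have hAh : A.card = h := by omega
  have hAh' : Aᶜ.card = h := by omega
  have hh' : (h : ℝ) ≠ 0 := by positivity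
  have hinv : ∀ a b, (a ∈ A ↔ b ∈ A) →
      score (centered (2 * h)) E a = score (centered (2 * h)) E b := by
    intro a b hab
    refine score_eq_of_relabel (fun v => ?_) _
    by_cases hv : Ahead A v
    · exact h2 _ _ ((ahead_relabel hab v).2 hv) hv
    · rw [count_eq_zero h1 hv, count_eq_zero h1 (fun h => hv ((ahead_relabel hab v).1 h))]
  have hsA : ∑ c ∈ A, score (centered (2 * h)) E c = -(n * (h : ℝ) ^ 2) := by
    simp only [score]
    rw [sum_comm, sum_congr rfl fun i _ => sum_centered_of_ahead hAh (h1 i)]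
    simp
  have hs : ∑ c, score (centered (2 * h)) E c = 0 := by
    rw [sum_score]
    simp only [centered, sum_sub_distrib, sum_range_odd]
    simp; right; ring
  rw [← sum_add_sum_compl A, hsA] at hs
  -- Any vote of the profile serves: they all place the members of `A` on the first `h` positions.
  refine ⟨E ⟨0, hn⟩, fun c => ?_⟩
  have hiff := mem_iff_lt_of_ahead (h1 ⟨0, hn⟩) c
  rw [hAh] at hiff
  rw [← if_congr hiff rfl rfl]
  split_ifs with hcA
  · rw [sum_congr rfl fun d hd => hinv d c (by simp [hd, hcA]), sum_const, nsmul_eq_mul,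
      hAh] at hsA
    refine mul_left_cancel₀ hh' ?_
    linarith
  · rw [sum_congr rfl fun d hd => hinv d c (by simp [mem_compl.1 hd, hcA]), sum_const,
      nsmul_eq_mul, hAh'] at hs
    refine mul_left_cancel₀ hh' ?_
    linarith

end Kinds

/-! ### The total displacement from the middle position, by kind -/

/-- The value of `score (centered (2 * h))` for a compass election of the given kind, at the
candidate with position `k` in a suitable vote. -/
noncomputable def drift (n h : ℕ) : Compass → ℕ → ℝ
  | .ID, k => n * centered (2 * h) k
  | .AN, _ => 0
  | .UN, _ => 0
  | .ST, k => if k < h then -(n * h : ℝ) else n * h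

lemma drift_monotone (n h : ℕ) (X : Compass) : Monotone (drift n h X) := by
  intro a b hab
  have hab' : (a : ℝ) ≤ b := by exact_mod_cast hab
  cases X with
  | ID =>
    refine mul_le_mul_of_nonneg_left ?_ n.cast_nonneg
    simp only [centered]; linarith
  | AN => exact le_rfl
  | UN => exact le_rfl
  | ST =>
    have : (0 : ℝ) ≤ n * h := by positivity
    simp only [drift]
    split_ifs with h1 h2 h2
    · exact le_rfl
    · linarith
    · omega
    · exact le_rfl

/-- With `k ≤ h` the prefix stays inside the top block of ST, where the drift is constant. -/
lemma sum_drift {n h : ℕ} (X : Compass) {k : ℕ} (hk : k ≤ h) :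
    ∑ j ∈ range k, drift n h X j = match X with
      | .ID => (n : ℝ) * (k * (k - 2 * h))
      | .AN => 0
      | .UN => 0
      | .ST => -((n : ℝ) * (h * k)) := by
  cases X with
  | ID =>
    simp only [drift, centered, ← mul_sum, sum_sub_distrib, sum_range_odd]
    simp; left; ring
  | AN => simp [drift]
  | UN => simp [drift]
  | ST =>
    have : ∀ j ∈ range k, drift n h .ST j = -(n * h : ℝ) := by
      intro j hj
      rw [drift, if_pos ((mem_range.1 hj).trans_le hk)]
    rw [sum_congr rfl this]
    simp; ring

/-- The prefix sums are ordered ID ≤ ST ≤ 0, and the smallest gap over all cases is the one between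
ID and ST. -/
lemma le_abs_sum_drift_sub {n h : ℕ} {X Y : Compass} (hXY : X ≠ Y)
    (hAU : s(X, Y) ≠ s(.AN, .UN)) {k : ℕ} (hk : k ≤ h) :
    (n : ℝ) * (k * (h - k)) ≤
      |∑ j ∈ range k, drift n h X j - ∑ j ∈ range k, drift n h Y j| := by
  have hk' : (k : ℝ) ≤ h := by exact_mod_cast hk
  have h1 : 0 ≤ (n : ℝ) * (k * (h - k)) := by
    have := sub_nonneg.2 hk'; positivity
  have h2 : 0 ≤ (n : ℝ) * (h * k) := by positivity
  have h3 : 0 ≤ (n : ℝ) * (k * k) := by positivity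
  rw [sum_drift X hk, sum_drift Y hk, le_abs]
  cases X <;> cases Y <;> simp only [ne_eq, not_true_eq_false, Sym2.eq_swap] at hXY hAU ⊢ <;>
    first
    | (left; linarith)
    | (right; linarith)

section Separation

variable {C : Type*} {D : Type*} [Fintype C] [Fintype D] [DecidableEq C] [DecidableEq D]
  {n h : ℕ}

lemma exists_score_eq_drift {X : Compass} {E : Profile C (2 * h) n} (hE : IsCompass X E)
    (hh : 0 < h) (hn : 0 < n) :
    ∃ v : Vote C (2 * h), ∀ c, score (centered (2 * h)) E c = drift n h X (v c) := by
  cases X with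
  | ID => exact (IsID.score hE).imp fun v hv c => hv _ c
  | AN => exact ⟨E ⟨0, hn⟩, fun c => IsAN.score_centered hE c⟩
  | UN => exact ⟨E ⟨0, hn⟩, fun c => IsUN.score_centered hE hh c⟩
  | ST => exact IsST.score_centered hE hh hn

lemma le_sum_abs_sub_symm {b : ℝ} {g : C → ℝ} {g' : D → ℝ}
    (H : ∀ σ : D ≃ C, b ≤ ∑ d, |g' d - g (σ d)|) (σ : C ≃ D) :
    b ≤ ∑ c, |g c - g' (σ c)| := by
  refine (H σ.symm).trans_eq ?_
  rw [← Equiv.sum_comp σ]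
  exact sum_congr rfl fun c _ => by rw [σ.symm_apply_apply, abs_sub_comm]

/-- Separates ID from ST. An arbitrary matching gives no control over the signs of `g'`, so the
reverse triangle inequality discards them. -/
lemma le_sum_abs_vote_sub_const (hh : 2 ≤ h) (v : Vote C (2 * h)) {g' : D → ℝ}
    (hg' : ∀ d, |g' d| = n * h) (σ : C ≃ D) :
    (n : ℝ) * h ^ 2 / 2 ≤ ∑ c, |n * centered (2 * h) (v c) - g' (σ c)| := by
  have h1 : ∀ c, (n : ℝ) * |(|centered (2 * h) (v c)| - h)|
      ≤ |n * centered (2 * h) (v c) - g' (σ c)| := by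
    intro c
    refine le_trans (le_of_eq ?_) (abs_abs_sub_abs_le_abs_sub _ _)
    rw [hg', abs_mul, Nat.abs_cast, ← mul_sub, abs_mul, Nat.abs_cast]
  refine le_trans ?_ (sum_le_sum fun c _ => h1 c)
  rw [← mul_sum, sum_vote v fun k => |(|centered (2 * h) k| - h)|, mul_div_assoc]
  exact mul_le_mul_of_nonneg_left (le_sum_abs_centered_sub hh) n.cast_nonneg

lemma le_sum_abs_drift_vote_sub (hh : 2 ≤ h) {X Y : Compass} (hXY : X ≠ Y)
    (hAU : s(X, Y) ≠ s(.AN, .UN)) (v : Vote C (2 * h)) (w : Vote D (2 * h)) (σ : C ≃ D) :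
    (n : ℝ) * h ^ 2 / 2 ≤ ∑ c, |drift n h X (v c) - drift n h Y (w (σ c))| := by
  have hnh : (0 : ℝ) ≤ n * h ^ 2 := by positivity
  have hAN : ∀ k, drift n h .AN k = 0 := fun _ => rfl
  have hUN : ∀ k, drift n h .UN k = 0 := fun _ => rfl
  have hST : ∀ k, |drift n h .ST k| = n * h := by
    intro k
    have : (0 : ℝ) ≤ n * h := by positivity
    rw [drift]; split_ifs
    · rw [abs_neg, abs_of_nonneg this]
    · exact abs_of_nonneg this
  have hID {B : Type _} [Fintype B] (u : Vote B (2 * h)) :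
      (n : ℝ) * h ^ 2 / 2 ≤ ∑ c, |drift n h .ID (u c)| := by
    rw [sum_vote u fun k => |drift n h .ID k|]
    simp only [drift, abs_mul, Nat.abs_cast]
    rw [← mul_sum, sum_abs_centered]
    linarith
  have hST' {B : Type _} [Fintype B] (u : Vote B (2 * h)) :
      (n : ℝ) * h ^ 2 / 2 ≤ ∑ c, |drift n h .ST (u c)| := by
    simp only [hST, sum_const, card_univ, card_of_vote u, nsmul_eq_mul]
    push_cast
    linarith
  cases X <;> cases Y <;> simp only [ne_eq, not_true_eq_false, Sym2.eq_swap] at hXY hAU ⊢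
  · simpa [drift] using hID v
  · simpa [drift] using hID v
  · exact le_sum_abs_vote_sub_const hh v (g' := fun d => drift n h .ST (w d)) (fun d => hST _) σ
  · simpa [drift] using hID (σ.trans w)
  · simpa only [hAN, hUN, zero_sub, abs_neg, Equiv.trans_apply] using hST' (σ.trans w)
  · simpa [drift] using hID (σ.trans w)
  · simpa only [hAN, hUN, zero_sub, abs_neg, Equiv.trans_apply] using hST' (σ.trans w)
  · refine le_sum_abs_sub_symm (g := fun c => drift n h .ST (v c))
      (g' := fun d => drift n h .ID (w d)) (fun τ => ?_) σ
    exact le_sum_abs_vote_sub_const hh w (g' := fun c => drift n h .ST (v c)) (fun d => hST _) τ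
  · simpa only [hAN, hUN, sub_zero] using hST' v
  · simpa only [hAN, hUN, sub_zero] using hST' v

lemma le_sum_abs_score_sub {X Y : Compass} (hXY : X ≠ Y) (hAU : s(X, Y) ≠ s(.AN, .UN))
    (hh : 2 ≤ h) (hn : 0 < n) {E : Profile C (2 * h) n} {E' : Profile D (2 * h) n}
    (hE : IsCompass X E) (hE' : IsCompass Y E') (σ : C ≃ D) :
    (n : ℝ) * h ^ 2 / 2 ≤
      ∑ c, |score (centered (2 * h)) E c - score (centered (2 * h)) E' (σ c)| := by
  obtain ⟨v, hv⟩ := exists_score_eq_drift hE (by omega) hn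
  obtain ⟨w, hw⟩ := exists_score_eq_drift hE' (by omega) hn
  simp only [hv, hw]
  exact le_sum_abs_drift_vote_sub hh hXY hAU v w σ

lemma le_sum_abs_score_sub_AN_UN (hh : 2 ≤ h) {E : Profile C (2 * h) n}
    {E' : Profile D (2 * h) n} (hE : IsAN E) (hE' : IsUN E') (σ : C ≃ D) :
    (n : ℝ) * h ^ 2 / 2 ≤ ∑ c, |score (fun k => |centered (2 * h) k|) E c -
      score (fun k => |centered (2 * h) k|) E' (σ c)| := by
  obtain ⟨v, hv⟩ := hE.score_abs_centered
  simp only [hv, hE'.score_abs_centered (show 0 < h by omega), ← mul_sub, abs_mul, Nat.abs_cast]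
  rw [← mul_sum, sum_vote v fun k => |(|centered (2 * h) k| - h)|, mul_div_assoc]
  exact mul_le_mul_of_nonneg_left (le_sum_abs_centered_sub hh) n.cast_nonneg

lemma abs_centered_step (m k : ℕ) : |centered m (k + 1) - centered m k| ≤ 2 := by
  have : centered m (k + 1) - centered m k = 2 := by simp only [centered]; push_cast; ring
  rw [this, abs_two]

lemma exists_separating_score {X Y : Compass} (hXY : X ≠ Y) (hh : 2 ≤ h) (hn : 0 < n)
    {E : Profile C (2 * h) n} {E' : Profile D (2 * h) n}
    (hE : IsCompass X E) (hE' : IsCompass Y E') :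
    ∃ f : ℕ → ℝ, (∀ k, |f (k + 1) - f k| ≤ 2) ∧ ∀ σ : C ≃ D,
      (n : ℝ) * h ^ 2 / 2 ≤ ∑ c, |score f E c - score f E' (σ c)| := by
  by_cases hAU : s(X, Y) = s(.AN, .UN)
  -- Taking absolute values is 1-Lipschitz, so the step bound 2 survives.
  · refine ⟨fun k => |centered (2 * h) k|, fun k =>
      (abs_abs_sub_abs_le_abs_sub _ _).trans (abs_centered_step _ _), ?_⟩
    rcases Sym2.eq_iff.1 hAU with ⟨rfl, rfl⟩ | ⟨rfl, rfl⟩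
    · exact le_sum_abs_score_sub_AN_UN hh hE hE'
    · exact le_sum_abs_sub_symm (le_sum_abs_score_sub_AN_UN hh hE' hE)
  · exact ⟨centered (2 * h), abs_centered_step _, le_sum_abs_score_sub hXY hAU hh hn hE hE'⟩

end Separation

/-! ### Bounds of the distances -/

/-- Nonemptiness matters: a real infimum over an empty type is `0` by convention. Below, a bijection
`C ≃ D` is obtained by composing a vote of one profile with the inverse of a vote of the other. -/
lemma iInf_mem_Icc {ι : Type*} [Nonempty ι] {f : ι → ℝ} {a b : ℝ} (hf : ∀ i, f i ∈ Set.Icc a b) :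
    ⨅ i, f i ∈ Set.Icc a b :=
  ⟨le_ciInf fun i => (hf i).1,
    (ciInf_le ⟨a, Set.forall_mem_range.2 fun i => (hf i).1⟩ (Classical.arbitrary ι)).trans
      (hf _).2⟩

section Distances

variable {C : Type*} {D : Type*} [Fintype C] [Fintype D] [DecidableEq C] [DecidableEq D]
  {m n : ℕ}

lemma sum_position (E : Profile C m n) (c : C) : ∑ j, (position E c j : ℝ) = n := by
  have := card_eq_sum_card_fiberwise (f := fun i => E i c) (s := univ) (t := univ) (by simp)
  rw [card_univ, Fintype.card_fin] at this
  simp only [position]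
  exact_mod_cast this.symm

lemma l1_position_le (E : Profile C m n) (E' : Profile D m n) (c : C) (d : D) :
    l1 (fun j => (position E c j : ℝ)) (fun j => (position E' d j : ℝ)) ≤ 2 * n := by
  rw [l1, two_mul]
  nth_rewrite 1 [← sum_position E c]
  rw [← sum_position E' d, ← sum_add_distrib]
  refine sum_le_sum fun j _ => (abs_sub _ _).trans ?_
  simp

/-- The factor 4 is the step bound 2 times the factor 2 of the footrule inequality. -/
lemma score_sub_le_swap {f : ℕ → ℝ} (hf : ∀ k, |f (k + 1) - f k| ≤ 2)
    (E : Profile C m n) (E' : Profile D m n) (σ : C ≃ D) (ρ : Equiv.Perm (Fin n)) :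
    ∑ c, |score f E c - score f E' (σ c)| ≤
      4 * ∑ i, swapVote (rename σ (E i)) (E' (ρ i)) := by
  have h1 : ∀ c, |score f E c - score f E' (σ c)| ≤
      ∑ i, 2 * |(E i c : ℝ) - E' (ρ i) (σ c)| := by
    intro c
    rw [score, score, ← Equiv.sum_comp ρ fun i => f (E' i (σ c)), ← sum_sub_distrib]
    exact (abs_sum_le_sum_abs _ _).trans (sum_le_sum fun i _ => abs_sub_le_of_step hf _ _)
  refine (sum_le_sum fun c _ => h1 c).trans ?_
  rw [sum_comm, mul_sum]
  refine sum_le_sum fun i _ => ?_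
  have h2 := sum_abs_sub_le_swapVote (rename σ (E i)) (E' (ρ i))
  rw [← Equiv.sum_comp σ] at h2
  have h3 : ∀ c, rename σ (E i) (σ c) = E i c := fun c => by simp [rename]
  simp only [h3] at h2
  rw [← mul_sum]
  linarith

/-- Borda scores are row sums of the majority matrix, and the centred score is a constant minus
twice the Borda score. Diagonal terms vanish. -/
lemma score_sub_le_pair (E : Profile C m n) (E' : Profile D m n) (σ : C ≃ D) :
    ∑ c, |score (centered m) E c - score (centered m) E' (σ c)| ≤
      2 * ∑ p ∈ (univ : Finset C).offDiag,
        |(majority E p.1 p.2 : ℝ) - (majority E' (σ p.1) (σ p.2) : ℝ)| := by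
  have h1 : ∀ c, |score (centered m) E c - score (centered m) E' (σ c)| ≤
      2 * ∑ d, |(majority E c d : ℝ) - majority E' (σ c) (σ d)| := by
    intro c
    have e1 := two_mul_borda E c
    have e2 := two_mul_borda E' (σ c)
    have e3 : score (centered m) E c - score (centered m) E' (σ c) =
        2 * ((borda E' (σ c) : ℝ) - borda E c) := by linarith
    rw [e3, abs_mul, abs_two, abs_sub_comm, borda_eq_sum_majority, borda_eq_sum_majority,
      ← Equiv.sum_comp σ fun d => (majority E' (σ c) d : ℝ), ← sum_sub_distrib]
    exact mul_le_mul_of_nonneg_left (abs_sum_le_sum_abs _ _) zero_le_two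
  refine (sum_le_sum fun c _ => h1 c).trans ?_
  rw [← mul_sum]
  refine mul_le_mul_of_nonneg_left (le_of_eq ?_) zero_le_two
  rw [← sum_product' univ univ fun c d => |(majority E c d : ℝ) - majority E' (σ c) (σ d)|]
  symm
  refine sum_subset (fun p _ => by simp) fun p _ hp => ?_
  have : p.1 = p.2 := by simpa using hp
  simp [this, majority]

lemma majority_le (E : Profile C m n) (a b : C) : (majority E a b : ℝ) ≤ n := by
  have := card_le_univ (univ.filter fun i => E i a < E i b)
  rw [Fintype.card_fin] at this
  exact_mod_cast this

lemma sum_pair_le (E : Profile C m n) (E' : Profile D m n) (hC : Fintype.card C = m)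
    (σ : C ≃ D) :
    ∑ p ∈ (univ : Finset C).offDiag,
      |(majority E p.1 p.2 : ℝ) - (majority E' (σ p.1) (σ p.2) : ℝ)| ≤ n * m ^ 2 := by
  have h1 : ∀ p ∈ (univ : Finset C).offDiag,
      |(majority E p.1 p.2 : ℝ) - (majority E' (σ p.1) (σ p.2) : ℝ)| ≤ n := fun p _ =>
    abs_sub_le_of_nonneg_of_le (Nat.cast_nonneg _) (majority_le _ _ _) (Nat.cast_nonneg _)
      (majority_le _ _ _)
  have h2 : ((univ : Finset C).offDiag.card : ℝ) ≤ (m : ℝ) ^ 2 := by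
    have : (univ : Finset C).offDiag.card ≤ m ^ 2 := by
      rw [offDiag_card, card_univ, hC, sq]; exact Nat.sub_le _ _
    exact_mod_cast this
  refine (sum_le_card_nsmul _ _ _ h1).trans ?_
  rw [nsmul_eq_mul, mul_comm]
  exact mul_le_mul_of_nonneg_left h2 n.cast_nonneg

/-! ### Sorted Borda scores and the Bordawise distance -/

lemma sortDesc_apply {x : C → ℕ} (e : Fin m ≃ C) (he : Antitone (x ∘ e)) (i : Fin m) :
    sortDesc m x i = x (e i) := by
  have h1 : (univ : Finset C).val.map x = (List.ofFn (x ∘ e) : Multiset ℕ) := by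
    have h2 : (univ : Finset C) = (univ : Finset (Fin m)).map e.toEmbedding := by simp
    rw [h2, map_val, Multiset.map_map, List.ofFn_eq_map]
    rw [← Multiset.map_coe]
    rfl
  have h3 : ((univ : Finset C).val.map x).sort (· ≥ ·) = List.ofFn (x ∘ e) := by
    rw [h1, Multiset.coe_sort]
    refine List.mergeSort_of_pairwise ?_
    rw [List.pairwise_ofFn]
    intro a b hab
    simpa using he hab.le
  rw [sortDesc, h3]
  simp

/-- As `F` is monotone, the order of `v` already lists the Borda scores in nonincreasing order, so
sorting amounts to reading along `v`. -/
lemma sortDesc_borda {E : Profile C m n} {v : Vote C m} {F : ℕ → ℝ} (hF : Monotone F)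
    (hv : ∀ c, score (centered m) E c = F (v c)) (i : Fin m) :
    2 * sortDesc m (borda E) i = n * (m - 1) - F i ∧
      sortDesc m (borda E) i ∈ Set.Icc (0 : ℝ) (n * m) := by
  have hanti : Antitone (borda E ∘ v.symm) := by
    intro a b hab
    have e1 := two_mul_borda E (v.symm a)
    have e2 := two_mul_borda E (v.symm b)
    rw [hv, Equiv.apply_symm_apply] at e1 e2
    have := hF (show (a : ℕ) ≤ b from hab)
    have : (borda E (v.symm b) : ℝ) ≤ borda E (v.symm a) := by linarith
    exact_mod_cast this
  rw [sortDesc_apply v.symm hanti]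
  refine ⟨by rw [two_mul_borda, hv, Equiv.apply_symm_apply], Nat.cast_nonneg _, ?_⟩
  have : borda E (v.symm i) ≤ n * m := by
    refine (sum_le_card_nsmul _ _ m fun j _ => Nat.sub_le _ _).trans (by simp)
  exact_mod_cast this

lemma prefixSum_eq {x : Fin m → ℝ} {F : ℕ → ℝ} (hx : ∀ i : Fin m, x i = F i) (i : Fin m) :
    prefixSum x i = ∑ j ∈ range (i + 1), F j := by
  rw [prefixSum, sum_congr rfl fun j _ => hx j]
  refine sum_bij (fun j _ => (j : ℕ)) ?_ ?_ ?_ ?_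
  · intro j hj
    have : j ≤ i := mem_Iic.1 hj
    rw [mem_range]; exact Nat.lt_succ_of_le this
  · intro j _ k _ hjk; exact Fin.ext hjk
  · intro k hk
    rw [mem_range] at hk
    exact ⟨⟨k, by omega⟩, by rw [mem_Iic, Fin.le_iff_val_le_val]; simp; omega, rfl⟩
  · intro j _; rfl

lemma sum_succ_mul_sub (M : ℝ) (N : ℕ) : ∑ i ∈ range N, (((i + 1 : ℕ) : ℝ) * (M - (i + 1 : ℕ))) =
    M * (N * (N + 1)) / 2 - N * (N + 1) * (2 * N + 1) / 6 := by
  induction N with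
  | zero => simp
  | succ k ih => rw [sum_range_succ, ih]; push_cast; ring

lemma dBorda_mem_Icc {h : ℕ} {X Y : Compass} (hXY : X ≠ Y) (hAU : s(X, Y) ≠ s(.AN, .UN))
    (hh : 2 ≤ h) (hn : 0 < n) {E : Profile C (2 * h) n} {E' : Profile D (2 * h) n}
    (hE : IsCompass X E) (hE' : IsCompass Y E') :
    dBorda E E' ∈ Set.Icc ((n : ℝ) * h ^ 3 / 16) ((n : ℝ) * (2 * h) ^ 3) := by
  obtain ⟨v, hv⟩ := exists_score_eq_drift hE (by omega) hn
  obtain ⟨w, hw⟩ := exists_score_eq_drift hE' (by omega) hn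
  have hx := sortDesc_borda (drift_monotone n h X) hv
  have hy := sortDesc_borda (drift_monotone n h Y) hw
  rw [dBorda]
  constructor
  -- Only the first `h` prefix sums are kept. Their bounds add up to `n * h * (h ^ 2 - 1) / 12`,
  -- which is at least `n * h ^ 3 / 16` since `h ≥ 2`.
  · have hpre : ∀ i : Fin (2 * h), (if (i : ℕ) < h then
        (n : ℝ) / 2 * (((i + 1 : ℕ) : ℝ) * (h - (i + 1 : ℕ))) else 0) ≤
        |prefixSum (sortDesc (2 * h) (borda E)) i - prefixSum (sortDesc (2 * h) (borda E')) i| := by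
      intro i
      split_ifs with hi
      · rw [prefixSum_eq (F := fun k => (n * ((2 * h : ℕ) - 1) - drift n h X k) / 2)
            (fun i => by linarith [(hx i).1]),
          prefixSum_eq (F := fun k => (n * ((2 * h : ℕ) - 1) - drift n h Y k) / 2)
            (fun i => by linarith [(hy i).1]), ← sum_div, ← sum_div, sum_sub_distrib,
          sum_sub_distrib, ← sub_div, sub_sub_sub_cancel_left, abs_div, abs_two, abs_sub_comm]
        have := le_abs_sum_drift_sub (n := n) hXY hAU (Nat.succ_le_of_lt hi)
        linarith
      · exact abs_nonneg _
    rw [emd, l1]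
    refine le_trans ?_ (sum_le_sum fun i _ => hpre i)
    rw [Fin.sum_univ_eq_sum_range (fun i => if i < h then
        (n : ℝ) / 2 * (((i + 1 : ℕ) : ℝ) * (h - (i + 1 : ℕ))) else 0), ← sum_filter]
    have : (range (2 * h)).filter (fun i => i < h) = range h := by ext; simp; omega
    rw [this, ← mul_sum, sum_succ_mul_sub]
    have hh' : (2 : ℝ) ≤ h := by exact_mod_cast hh
    have h4 : (4 : ℝ) ≤ h ^ 2 := by nlinarith
    have hp : 0 ≤ (n : ℝ) * h * (h ^ 2 - 4) :=
      mul_nonneg (by positivity) (by linarith)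
    nlinarith
  · refine (emd_le_mul_l1 _ _).trans ?_
    have h1 : l1 (sortDesc (2 * h) (borda E)) (sortDesc (2 * h) (borda E')) ≤
        ∑ _i : Fin (2 * h), (n : ℝ) * (2 * h : ℕ) :=
      sum_le_sum fun i _ => abs_sub_le_of_nonneg_of_le (hx i).2.1 (hx i).2.2 (hy i).2.1 (hy i).2.2
    refine (mul_le_mul_of_nonneg_left h1 (Nat.cast_nonneg _)).trans (le_of_eq ?_)
    simp; ring

/-! ### Pairwise, positionwise, swap and discrete distances -/

variable {h : ℕ} {X Y : Compass}

lemma dPair_mem_Icc (hXY : X ≠ Y) (hAU : s(X, Y) ≠ s(.AN, .UN))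
    (hh : 2 ≤ h) (hn : 0 < n) {E : Profile C (2 * h) n} {E' : Profile D (2 * h) n}
    (hE : IsCompass X E) (hE' : IsCompass Y E') :
    dPair E E' ∈ Set.Icc ((n : ℝ) * h ^ 2 / 4) ((n : ℝ) * (2 * h) ^ 2) := by
  have : Nonempty (C ≃ D) := ⟨(E ⟨0, hn⟩).trans (E' ⟨0, hn⟩).symm⟩
  refine iInf_mem_Icc fun σ => ⟨?_, ?_⟩
  · have h1 := le_sum_abs_score_sub hXY hAU hh hn hE hE' σ
    have h2 := score_sub_le_pair E E' σ
    linarith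
  · have := sum_pair_le E E' (card_of_vote (E ⟨0, hn⟩)) σ
    push_cast at this
    exact this

lemma sum_emd_position_le (E : Profile C m n) (E' : Profile D m n) (σ : C ≃ D) :
    ∑ c, emd (fun j => (position E c j : ℝ)) (fun j => (position E' (σ c) j : ℝ)) ≤
      m * ∑ c, l1 (fun j => (position E c j : ℝ)) (fun j => (position E' (σ c) j : ℝ)) := by
  rw [mul_sum]
  exact sum_le_sum fun c _ => emd_le_mul_l1 _ _

lemma sum_l1_position_le (E : Profile C m n) (E' : Profile D m n) (hC : Fintype.card C = m)
    (σ : C ≃ D) :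
    ∑ c, l1 (fun j => (position E c j : ℝ)) (fun j => (position E' (σ c) j : ℝ)) ≤
      2 * (n * m) := by
  refine (sum_le_sum fun c _ => l1_position_le E E' c (σ c)).trans (le_of_eq ?_)
  simp [hC]; ring

lemma le_sum_emd_position (hXY : X ≠ Y) (hh : 2 ≤ h) (hn : 0 < n) {E : Profile C (2 * h) n}
    {E' : Profile D (2 * h) n} (hE : IsCompass X E) (hE' : IsCompass Y E') (σ : C ≃ D) :
    (n : ℝ) * h ^ 2 / 4 ≤
      ∑ c, emd (fun j => (position E c j : ℝ)) (fun j => (position E' (σ c) j : ℝ)) := by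
  obtain ⟨f, hf, hsep⟩ := exists_separating_score hXY hh hn hE hE'
  have h1 := (hsep σ).trans (sum_le_sum fun c _ => abs_score_sub_le_emd hf E E' c (σ c))
  rw [← mul_sum] at h1
  linarith

lemma dPosEmd_mem_Icc (hXY : X ≠ Y) (hh : 2 ≤ h) (hn : 0 < n) {E : Profile C (2 * h) n}
    {E' : Profile D (2 * h) n} (hE : IsCompass X E) (hE' : IsCompass Y E') :
    dPosEmd E E' ∈ Set.Icc ((n : ℝ) * h ^ 2 / 4) (2 * ((n : ℝ) * (2 * h) ^ 2)) := by
  have : Nonempty (C ≃ D) := ⟨(E ⟨0, hn⟩).trans (E' ⟨0, hn⟩).symm⟩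
  refine iInf_mem_Icc fun σ => ⟨le_sum_emd_position hXY hh hn hE hE' σ,
    (sum_emd_position_le E E' σ).trans ?_⟩
  refine (mul_le_mul_of_nonneg_left (sum_l1_position_le E E' (card_of_vote (E ⟨0, hn⟩)) σ)
    (Nat.cast_nonneg _)).trans (le_of_eq ?_)
  push_cast; ring

lemma dPosL1_mem_Icc (hXY : X ≠ Y) (hh : 2 ≤ h) (hn : 0 < n) {E : Profile C (2 * h) n}
    {E' : Profile D (2 * h) n} (hE : IsCompass X E) (hE' : IsCompass Y E') :
    dPosL1 E E' ∈ Set.Icc ((n : ℝ) * h / 8) (2 * ((n : ℝ) * (2 * h))) := by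
  have : Nonempty (C ≃ D) := ⟨(E ⟨0, hn⟩).trans (E' ⟨0, hn⟩).symm⟩
  refine iInf_mem_Icc fun σ => ⟨?_, ?_⟩
  · have h1 := (le_sum_emd_position hXY hh hn hE hE' σ).trans (sum_emd_position_le E E' σ)
    push_cast at h1
    have hh' : (0 : ℝ) < 2 * h := by positivity
    refine le_of_mul_le_mul_left ?_ hh'
    linarith
  · have := sum_l1_position_le E E' (card_of_vote (E ⟨0, hn⟩)) σ
    push_cast at this
    exact this

lemma le_sum_swapVote (hXY : X ≠ Y) (hh : 2 ≤ h) (hn : 0 < n) {E : Profile C (2 * h) n}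
    {E' : Profile D (2 * h) n} (hE : IsCompass X E) (hE' : IsCompass Y E') (σ : C ≃ D)
    (ρ : Equiv.Perm (Fin n)) :
    (n : ℝ) * h ^ 2 / 8 ≤ ∑ i, swapVote (rename σ (E i)) (E' (ρ i)) := by
  obtain ⟨f, hf, hsep⟩ := exists_separating_score hXY hh hn hE hE'
  have h1 := (hsep σ).trans (score_sub_le_swap hf E E' σ ρ)
  linarith

lemma sum_swapVote_le (E : Profile C m n) (E' : Profile D m n) (σ : C ≃ D)
    (ρ : Equiv.Perm (Fin n)) : ∑ i, swapVote (rename σ (E i)) (E' (ρ i)) ≤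
      (m : ℝ) ^ 2 * ∑ i, discVote (rename σ (E i)) (E' (ρ i)) := by
  rw [mul_sum]
  exact sum_le_sum fun i _ => swapVote_le _ _

lemma sum_discVote_le (E : Profile C m n) (E' : Profile D m n) (σ : C ≃ D)
    (ρ : Equiv.Perm (Fin n)) : ∑ i, discVote (rename σ (E i)) (E' (ρ i)) ≤ n := by
  have : ∀ i, discVote (rename σ (E i)) (E' (ρ i)) ≤ 1 := by
    intro i; rw [discVote]; split_ifs <;> norm_num
  exact (sum_le_sum fun i _ => this i).trans (by simp)

lemma dSwap_mem_Icc (hXY : X ≠ Y) (hh : 2 ≤ h) (hn : 0 < n) {E : Profile C (2 * h) n}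
    {E' : Profile D (2 * h) n} (hE : IsCompass X E) (hE' : IsCompass Y E') :
    dSwap E E' ∈ Set.Icc ((n : ℝ) * h ^ 2 / 8) ((n : ℝ) * (2 * h) ^ 2) := by
  have : Nonempty (C ≃ D) := ⟨(E ⟨0, hn⟩).trans (E' ⟨0, hn⟩).symm⟩
  refine iInf_mem_Icc fun σ => iInf_mem_Icc fun ρ => ⟨le_sum_swapVote hXY hh hn hE hE' σ ρ, ?_⟩
  refine (sum_swapVote_le E E' σ ρ).trans ((mul_le_mul_of_nonneg_left
    (sum_discVote_le E E' σ ρ) (by positivity)).trans (le_of_eq ?_))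
  push_cast; ring

lemma dDisc_mem_Icc (hXY : X ≠ Y) (hh : 2 ≤ h) (hn : 0 < n) {E : Profile C (2 * h) n}
    {E' : Profile D (2 * h) n} (hE : IsCompass X E) (hE' : IsCompass Y E') :
    dDisc E E' ∈ Set.Icc ((n : ℝ) / 32) n := by
  have : Nonempty (C ≃ D) := ⟨(E ⟨0, hn⟩).trans (E' ⟨0, hn⟩).symm⟩
  refine iInf_mem_Icc fun σ => iInf_mem_Icc fun ρ => ⟨?_, sum_discVote_le E E' σ ρ⟩
  have h1 := (le_sum_swapVote hXY hh hn hE hE' σ ρ).trans (sum_swapVote_le E E' σ ρ)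
  push_cast at h1
  have hh' : (0 : ℝ) < (2 * h) ^ 2 := by positivity
  refine le_of_mul_le_mul_left ?_ hh'
  linarith

/-! ### Antagonism and uniformity -/

lemma dPair_eq_zero (hn : 0 < n) {E : Profile C m n} {E' : Profile D m n}
    (hE : ∀ a b, a ≠ b → (majority E a b : ℝ) = n / 2)
    (hE' : ∀ a b, a ≠ b → (majority E' a b : ℝ) = n / 2) : dPair E E' = 0 := by
  have : Nonempty (C ≃ D) := ⟨(E ⟨0, hn⟩).trans (E' ⟨0, hn⟩).symm⟩
  have hz : ∀ σ : C ≃ D, ∑ p ∈ (univ : Finset C).offDiag,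
      |(majority E p.1 p.2 : ℝ) - (majority E' (σ p.1) (σ p.2) : ℝ)| = 0 := by
    intro σ
    refine sum_eq_zero fun p hp => ?_
    have hp' : p.1 ≠ p.2 := (mem_offDiag.1 hp).2.2
    rw [hE _ _ hp', hE' _ _ (σ.injective.ne hp'), sub_self, abs_zero]
  rw [dPair, iInf_congr hz, ciInf_const]

/-- With all centred scores zero the Borda scores are constant, so any vote sorts them. -/
lemma dBorda_eq_zero (hn : 0 < n) {E : Profile C m n} {E' : Profile D m n}
    (hE : ∀ c, score (centered m) E c = 0) (hE' : ∀ c, score (centered m) E' c = 0) :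
    dBorda E E' = 0 := by
  have hx := sortDesc_borda (F := fun _ => 0) monotone_const (v := E ⟨0, hn⟩) hE
  have hy := sortDesc_borda (F := fun _ => 0) monotone_const (v := E' ⟨0, hn⟩) hE'
  have : sortDesc m (borda E) = sortDesc m (borda E') := by
    funext i; linarith [(hx i).1, (hy i).1]
  simp [dBorda, this, emd, l1]

end Distances

end Election

theorem proposition3 :
    (∃ c K : ℝ, 0 < c ∧ 0 < K ∧
      ∀ X Y : Election.Compass, X ≠ Y →
      ∀ m n t : ℕ, 4 ≤ m → Even m → 0 < t → n = t * m ! →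
      ∀ (C : Type u) (D : Type v) [Fintype C] [Fintype D] [DecidableEq C] [DecidableEq D]
        (E : Election.Profile C m n) (E' : Election.Profile D m n),
        Election.IsCompass X E → Election.IsCompass Y E' →
        (s(X, Y) ≠ s(Election.Compass.AN, Election.Compass.UN) →
          Election.dBorda E E' ∈ Set.Icc (c * (n * m ^ 3)) (K * (n * m ^ 3)) ∧
          Election.dPair E E' ∈ Set.Icc (c * (n * m ^ 2)) (K * (n * m ^ 2))) ∧
        Election.dSwap E E' ∈ Set.Icc (c * (n * m ^ 2)) (K * (n * m ^ 2)) ∧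
        Election.dPosEmd E E' ∈ Set.Icc (c * (n * m ^ 2)) (K * (n * m ^ 2)) ∧
        Election.dPosL1 E E' ∈ Set.Icc (c * (n * m)) (K * (n * m)) ∧
        Election.dDisc E E' ∈ Set.Icc (c * n) (K * n)) ∧
    (∀ m n t : ℕ, 2 ≤ m → Even m → 0 < t → n = t * m ! →
      ∀ (C : Type u) (D : Type v) [Fintype C] [Fintype D] [DecidableEq C] [DecidableEq D]
        (E : Election.Profile C m n) (E' : Election.Profile D m n),
        Election.IsCompass .AN E → Election.IsCompass .UN E' →
        Election.dPair E E' = 0 ∧ Election.dPair E' E = 0 ∧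
        Election.dBorda E E' = 0 ∧ Election.dBorda E' E = 0) := by
  constructor
  -- The Borda lower bound `n * h ^ 3 / 16 = n * m ^ 3 / 128` dictates the first constant, the
  -- positionwise upper bounds the second.
  · refine ⟨1 / 128, 2, by norm_num, by norm_num, ?_⟩
    intro X Y hXY m n t hm hev ht hnt C D _ _ _ _ E E' hE hE'
    have hn : 0 < n := hnt ▸ Nat.mul_pos ht m.factorial_pos
    obtain ⟨h, rfl⟩ := even_iff_two_dvd.1 hev
    have hh : 2 ≤ h := by omega
    have p1 : (0 : ℝ) ≤ n * h := by positivity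
    have p2 : (0 : ℝ) ≤ n * h ^ 2 := by positivity
    have p3 : (0 : ℝ) ≤ n * h ^ 3 := by positivity
    have p0 : (0 : ℝ) ≤ n := by positivity
    push_cast
    refine ⟨fun hAU => ⟨?_, ?_⟩, ?_, ?_, ?_, ?_⟩
    · exact Set.Icc_subset_Icc (by linarith) (by linarith)
        (Election.dBorda_mem_Icc hXY hAU hh hn hE hE')
    · exact Set.Icc_subset_Icc (by linarith) (by linarith)
        (Election.dPair_mem_Icc hXY hAU hh hn hE hE')
    · exact Set.Icc_subset_Icc (by linarith) (by linarith)
        (Election.dSwap_mem_Icc hXY hh hn hE hE')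
    · exact Set.Icc_subset_Icc (by linarith) (by linarith)
        (Election.dPosEmd_mem_Icc hXY hh hn hE hE')
    · exact Set.Icc_subset_Icc (by linarith) (by linarith)
        (Election.dPosL1_mem_Icc hXY hh hn hE hE')
    · exact Set.Icc_subset_Icc (by linarith) (by linarith)
        (Election.dDisc_mem_Icc hXY hh hn hE hE')
  · intro m n t hm hev ht hnt C D _ _ _ _ E E' hE hE'
    have hn : 0 < n := hnt ▸ Nat.mul_pos ht m.factorial_pos
    obtain ⟨h, rfl⟩ := even_iff_two_dvd.1 hev
    have hM : ∀ a b, a ≠ b → (Election.majority E a b : ℝ) = n / 2 :=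
      fun a b hab => Election.IsAN.majority hE hab
    have hM' : ∀ a b, a ≠ b → (Election.majority E' a b : ℝ) = n / 2 :=
      fun a b hab => Election.IsUN.majority hE' hab
    have hS := Election.IsAN.score_centered hE
    have hS' := Election.IsUN.score_centered hE' (show 0 < h by omega)
    exact ⟨Election.dPair_eq_zero hn hM hM', Election.dPair_eq_zero hn hM' hM,
      Election.dBorda_eq_zero hn hS hS', Election.dBorda_eq_zero hn hS' hS⟩
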